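/- Let $R$ be an associative ring with identity; all modules are unitary. A left $R$-module $M$ is Gorenstein flat if there is an exact sequence of flat left $R$-modules $\cdots\to F_1\to F_0\to F^0\to F^1\to\cdots$ such that $M\cong\operatorname{Im}(F_0\to F^0)$ and such that $I\otimes_R-$ leaves the sequence exact for every injective right $R$-module $I$. The Gorenstein flat dimension $\operatorname{Gfd}_R(M)\in\{0,1,2,\dots\}\cup\{\infty\}$ is the least integer $n\ge 0$ for which there is an exact sequence $0\to G_n\to\cdots\to G_0\to M\to 0$ with every $G_i$ a Gorenstein flat left $R$-module, and $\operatorname{Gfd}_R(M)=\infty$ if there is no such $n$ (so $\operatorname{Gfd}_R(0)=0$). The ring $R$ is left GF-closed if the class of Gorenstein flat left $R$-modules is closed under extensions: for every short exact sequence $0\to A\to B\to C\to 0$ of left $R$-modules with $A$ and $C$ Gorenstein flat, $B$ is Gorenstein flat. Theorem. Let $R$ be a left GF-closed ring and let $0\to A\to B\to C\to 0$ be a short exact sequence of left $R$-modules. Then, with the conventions $\infty\pm1=\infty$: 1. If any two of the modules $A$, $B$, $C$ have finite Gorenstein flat dimension, then so has the third. 2. $\operatorname{Gfd}_R(A)\le\sup\{\operatorname{Gfd}_R(B),\operatorname{Gfd}_R(C)-1\}$,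 with equality if $\operatorname{Gfd}_R(B)\ne\operatorname{Gfd}_R(C)$. 3. $\operatorname{Gfd}_R(B)\le\sup\{\operatorname{Gfd}_R(A),\operatorname{Gfd}_R(C)\}$, with equality if $\operatorname{Gfd}_R(C)\ne\operatorname{Gfd}_R(A)+1$. 4. $\operatorname{Gfd}_R(C)\le\sup\{\operatorname{Gfd}_R(B),\operatorname{Gfd}_R(A)+1\}$, with equality if $\operatorname{Gfd}_R(B)\ne\operatorname{Gfd}_R(A)$. -/

import Mathlib

/-! Left modules over a (not necessarily commutative) ring `R` are modules over `R`;
right `R`-modules are modules over the opposite ring `Rᵐᵒᵖ`, with `x r = op r • x`. -/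

open scoped TensorProduct

universe u

namespace GorensteinFlat

section Tensor

variable (R : Type u) [Ring R]

/-- The subgroup of `N ⊗_ℤ M` generated by the balancing relations `x r ⊗ y - x ⊗ r y`. -/
def balancedRel (N M : Type u) [AddCommGroup N] [Module Rᵐᵒᵖ N] [AddCommGroup M] [Module R M] :
    AddSubgroup (N ⊗[ℤ] M) :=
  AddSubgroup.closure
    {t | ∃ (x : N) (r : R) (y : M), t = (MulOpposite.op r • x) ⊗ₜ[ℤ] y - x ⊗ₜ[ℤ] (r • y)}

/-- The tensor product `N ⊗_R M` of a right `R`-module `N` and a left `R`-module `M`,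
an abelian group. -/
abbrev RTensor (N M : Type u) [AddCommGroup N] [Module Rᵐᵒᵖ N] [AddCommGroup M] [Module R M] :
    Type u :=
  (N ⊗[ℤ] M) ⧸ balancedRel R N M

variable {N N' M M' : Type u}
  [AddCommGroup N] [Module Rᵐᵒᵖ N] [AddCommGroup N'] [Module Rᵐᵒᵖ N']
  [AddCommGroup M] [Module R M] [AddCommGroup M'] [Module R M']

/-- The homomorphism `g ⊗_ℤ f : N ⊗_ℤ M → N' ⊗_ℤ M'`. -/
def intTensorMap (g : N →ₗ[Rᵐᵒᵖ] N') (f : M →ₗ[R] M') : N ⊗[ℤ] M →+ N' ⊗[ℤ] M' :=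
  (TensorProduct.map g.toAddMonoidHom.toIntLinearMap
    f.toAddMonoidHom.toIntLinearMap).toAddMonoidHom

theorem balancedRel_le_comap (g : N →ₗ[Rᵐᵒᵖ] N') (f : M →ₗ[R] M') :
    balancedRel R N M ≤ (balancedRel R N' M').comap (intTensorMap R g f) := by
  refine (AddSubgroup.closure_le _).2 ?_
  rintro _ ⟨x, r, y, rfl⟩
  refine AddSubgroup.subset_closure ⟨g x, r, f y, ?_⟩
  simp [intTensorMap]

/-- The homomorphism `g ⊗_R f : N ⊗_R M → N' ⊗_R M'`. -/
def tensorMap (g : N →ₗ[Rᵐᵒᵖ] N') (f : M →ₗ[R] M') : RTensor R N M →+ RTensor R N' M' :=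
  QuotientAddGroup.map _ _ (intTensorMap R g f) (balancedRel_le_comap R g f)

end Tensor

/-- A left `R`-module `M` is flat if `- ⊗_R M` preserves injectivity of homomorphisms of right
`R`-modules. -/
def IsFlat (R : Type u) [Ring R] (M : Type u) [AddCommGroup M] [Module R M] : Prop :=
  ∀ (N N' : Type u) [AddCommGroup N] [Module Rᵐᵒᵖ N] [AddCommGroup N'] [Module Rᵐᵒᵖ N']
    (g : N →ₗ[Rᵐᵒᵖ] N'), Function.Injective g →
      Function.Injective (tensorMap R g (LinearMap.id : M →ₗ[R] M))

/-- A left `R`-module `M` is Gorenstein flat if there is an exact sequence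
`⋯ → F (-1) → F 0 → F 1 → F 2 → ⋯` of flat left `R`-modules with `M ≅ Im (F 0 → F 1)` that stays
exact under `I ⊗_R -` for every injective right `R`-module `I`. -/
def IsGorensteinFlat (R : Type u) [Ring R] (M : Type u) [AddCommGroup M] [Module R M] : Prop :=
  ∃ (F : ℤ → ModuleCat.{u} R) (d : ∀ n : ℤ, F n →ₗ[R] F (n + 1)),
    (∀ n, IsFlat R (F n)) ∧
    (∀ n, Function.Exact (d n) (d (n + 1))) ∧
    Nonempty (M ≃ₗ[R] LinearMap.range (d 0)) ∧
    ∀ (I : Type u) [AddCommGroup I] [Module Rᵐᵒᵖ I], Module.Injective Rᵐᵒᵖ I →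
      ∀ n, Function.Exact
        (tensorMap R (LinearMap.id : I →ₗ[Rᵐᵒᵖ] I) (d n))
        (tensorMap R (LinearMap.id : I →ₗ[Rᵐᵒᵖ] I) (d (n + 1)))

/-- `R` is left GF-closed if the class of Gorenstein flat left `R`-modules is closed under
extensions. -/
def IsLeftGFClosed (R : Type u) [Ring R] : Prop :=
  ∀ (A B C : Type u) [AddCommGroup A] [Module R A] [AddCommGroup B] [Module R B]
    [AddCommGroup C] [Module R C] (f : A →ₗ[R] B) (g : B →ₗ[R] C),
    Function.Injective f → Function.Exact f g → Function.Surjective g →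
      IsGorensteinFlat R A → IsGorensteinFlat R C → IsGorensteinFlat R B

/-- `M` has a Gorenstein flat resolution of length `n`: an exact sequence
`0 → G n → ⋯ → G 0 → M → 0` with every `G i` Gorenstein flat. The sequence is continued by zero
modules beyond the degree `n`. -/
def HasGFResolution (R : Type u) [Ring R] (M : Type u) [AddCommGroup M] [Module R M] (n : ℕ) :
    Prop :=
  ∃ (G : ℕ → ModuleCat.{u} R) (d : ∀ i : ℕ, G (i + 1) →ₗ[R] G i) (ε : G 0 →ₗ[R] M),
    (∀ i, i ≤ n → IsGorensteinFlat R (G i)) ∧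
    (∀ i, n < i → Subsingleton (G i)) ∧
    (∀ i, Function.Exact (d (i + 1)) (d i)) ∧
    Function.Exact (d 0) ε ∧
    Function.Surjective ε

/-- The Gorenstein flat dimension: the least length of a Gorenstein flat resolution, and `⊤` if
there is none of finite length. -/
noncomputable def Gfd (R : Type u) [Ring R] (M : Type u) [AddCommGroup M] [Module R M] : ℕ∞ :=
  ⨅ (n : ℕ) (_ : HasGFResolution R M n), (n : ℕ∞)

end GorensteinFlat

/-! A module `M` is Gorenstein flat if and only if `Tor_k(I, M) = 0` for all `k ≥ 1` and all
injective right modules `I`, and `M` has a flat coresolution that stays exact under `I ⊗_R -`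
(`isGorensteinFlat_iff_tor`): under the vanishing condition the canonical free resolution of `M`
serves as the left half of a complete flat resolution. The vanishing condition is formulated without
derived functors, by means of the syzygies of `I`; what is needed about it is that `Tor_1` can be
computed from either variable (`tensorMap_injective_balanced`) and the dimension shift
`Tor_2(N, M) = Tor_1(Ω N, M) = Tor_1(N, K)` for `0 → K → F → M → 0` exact with `F` flat
(`torVanishes_syzygy_iff`).

It follows that the kernel of an epimorphism from a flat module onto a Gorenstein flat module is
Gorenstein flat (`IsGorensteinFlat.of_flat_epi`); in particular flat modules are Gorenstein flat. If
the Gorenstein flat modules are closed under extensions, they are then closed under kernels of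
epimorphisms (`IsLeftGFClosed.of_epi`): given `0 → A → B → C → 0` with `B` and `C` Gorenstein flat,
embed `B` into a flat module `F` with Gorenstein flat cokernel; then `F / A` is an extension of
`F / B` by `C`, and `A` is the kernel of `F → F / A`.

For a class of modules that contains the free modules and is closed under extensions and kernels of
epimorphisms, the modules with a resolution of length `n` by modules of the class are closed under
extensions, by induction on `n` (`resolutionsExtend`). The bounds for the kernel and the cokernel in
a short exact sequence follow from closure under extensions in the same degree
(`ResolutionsExtend.ker`, `ResolutionsExtend.coker`). The rest of the theorem is a formal
consequence of the three inequalities between dimensions. -/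

namespace GorensteinFlat

/-! ### Tensor products -/

section Tensor

variable (R : Type u) [Ring R] {N N' N'' M M' M'' : Type u}
  [AddCommGroup N] [Module Rᵐᵒᵖ N] [AddCommGroup N'] [Module Rᵐᵒᵖ N']
  [AddCommGroup N''] [Module Rᵐᵒᵖ N'']
  [AddCommGroup M] [Module R M] [AddCommGroup M'] [Module R M']
  [AddCommGroup M''] [Module R M'']

/-- The pure tensor `x ⊗ y` in `N ⊗_R M`. -/
def tmul (x : N) (y : M) : RTensor R N M := QuotientAddGroup.mk (x ⊗ₜ[ℤ] y)

theorem tmul_op_smul (x : N) (r : R) (y : M) :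
    tmul R (MulOpposite.op r • x) y = tmul R x (r • y) := by
  refine (QuotientAddGroup.eq_iff_sub_mem).2 (AddSubgroup.subset_closure ⟨x, r, y, rfl⟩)

theorem tmul_add (x : N) (y z : M) : tmul R x (y + z) = tmul R x y + tmul R x z := by
  simp [tmul, TensorProduct.tmul_add]

theorem add_tmul (x z : N) (y : M) : tmul R (x + z) y = tmul R x y + tmul R z y := by
  simp [tmul, TensorProduct.add_tmul]

variable {R}

@[simp]
theorem tensorMap_tmul (g : N →ₗ[Rᵐᵒᵖ] N') (f : M →ₗ[R] M') (x : N) (y : M) :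
    tensorMap R g f (tmul R x y) = tmul R (g x) (f y) := rfl

theorem rTensor_hom_ext {P : Type*} [AddCommGroup P] {φ ψ : RTensor R N M →+ P}
    (h : ∀ x y, φ (tmul R x y) = ψ (tmul R x y)) : φ = ψ := by
  refine QuotientAddGroup.addMonoidHom_ext _ (AddMonoidHom.ext fun t => ?_)
  induction t using TensorProduct.induction_on with
  | zero => simp
  | tmul x y => exact h x y
  | add a b ha hb => rw [map_add, map_add, ha, hb]

theorem tensorMap_comp (g' : N' →ₗ[Rᵐᵒᵖ] N'') (g : N →ₗ[Rᵐᵒᵖ] N')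
    (f' : M' →ₗ[R] M'') (f : M →ₗ[R] M') :
    tensorMap R (g' ∘ₗ g) (f' ∘ₗ f) = (tensorMap R g' f').comp (tensorMap R g f) :=
  rTensor_hom_ext fun _ _ => rfl

theorem tensorMap_id_comp (f' : M' →ₗ[R] M'') (f : M →ₗ[R] M') :
    ⇑(tensorMap R (LinearMap.id : N →ₗ[Rᵐᵒᵖ] N) (f' ∘ₗ f)) =
      tensorMap R LinearMap.id f' ∘ tensorMap R LinearMap.id f :=
  congrArg DFunLike.coe (tensorMap_comp LinearMap.id LinearMap.id f' f)

theorem tensorMap_comm (g : N →ₗ[Rᵐᵒᵖ] N') (f : M →ₗ[R] M') (t : RTensor R N M) :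
    tensorMap R LinearMap.id f (tensorMap R g LinearMap.id t) =
      tensorMap R g LinearMap.id (tensorMap R LinearMap.id f t) :=
  DFunLike.congr_fun (show (tensorMap R LinearMap.id f).comp (tensorMap R g LinearMap.id) =
    (tensorMap R g LinearMap.id).comp (tensorMap R LinearMap.id f) from
      rTensor_hom_ext fun _ _ => rfl) t

/-- The universal property of `N ⊗_R M`: a balanced biadditive map induces a homomorphism. -/
def tensorLift {P : Type*} [AddCommGroup P] (φ : N →+ M →+ P)
    (h : ∀ x (r : R) y, φ (MulOpposite.op r • x) y = φ x (r • y)) : RTensor R N M →+ P :=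
  QuotientAddGroup.lift _ (TensorProduct.liftAddHom φ fun n x y => by simp) <| by
    refine (AddSubgroup.closure_le _).2 ?_
    rintro _ ⟨x, r, y, rfl⟩
    simp [h]

theorem intTensorMap_surjective {g : N →ₗ[Rᵐᵒᵖ] N'} {f : M →ₗ[R] M'}
    (hg : Function.Surjective g) (hf : Function.Surjective f) :
    Function.Surjective (intTensorMap R g f) :=
  TensorProduct.map_surjective hg hf

theorem tensorMap_surjective {g : N →ₗ[Rᵐᵒᵖ] N'} {f : M →ₗ[R] M'}
    (hg : Function.Surjective g) (hf : Function.Surjective f) :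
    Function.Surjective (tensorMap R g f) := by
  intro t
  obtain ⟨t, rfl⟩ := QuotientAddGroup.mk_surjective t
  obtain ⟨s, rfl⟩ := intTensorMap_surjective hg hf t
  exact ⟨QuotientAddGroup.mk s, rfl⟩

/-- Exactness over `ℤ` descends to exactness over `R` because, for surjective maps, every balancing
relation in the target lifts to a balancing relation in the source. -/
theorem tensorMap_exact_of_int {g : N →ₗ[Rᵐᵒᵖ] N'} {f : M →ₗ[R] M'}
    {g' : N' →ₗ[Rᵐᵒᵖ] N''} {f' : M' →ₗ[R] M''}
    (hg' : Function.Surjective g') (hf' : Function.Surjective f')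
    (h : Function.Exact (intTensorMap R g f) (intTensorMap R g' f')) :
    Function.Exact (tensorMap R g f) (tensorMap R g' f') := by
  have hrel : balancedRel R N'' M'' ≤ (balancedRel R N' M').map (intTensorMap R g' f') := by
    refine (AddSubgroup.closure_le _).2 ?_
    rintro _ ⟨x, r, y, rfl⟩
    obtain ⟨x, rfl⟩ := hg' x
    obtain ⟨y, rfl⟩ := hf' y
    refine ⟨_, AddSubgroup.subset_closure ⟨x, r, y, rfl⟩, ?_⟩
    simp [intTensorMap]
  intro t
  constructor
  · obtain ⟨t, rfl⟩ := QuotientAddGroup.mk_surjective t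
    intro ht
    have ht' : intTensorMap R g' f' t ∈ balancedRel R N'' M'' :=
      (QuotientAddGroup.eq_zero_iff _).1 ht
    obtain ⟨s, hs, hst⟩ := hrel ht'
    obtain ⟨w, hw⟩ := (h (t - s)).1 (by rw [map_sub, hst, sub_self])
    refine ⟨QuotientAddGroup.mk w, ?_⟩
    change QuotientAddGroup.mk (intTensorMap R g f w) = _
    rw [hw, QuotientAddGroup.eq_iff_sub_mem, sub_sub_cancel_left]
    exact neg_mem hs
  · rintro ⟨s, rfl⟩
    obtain ⟨s, rfl⟩ := QuotientAddGroup.mk_surjective s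
    change QuotientAddGroup.mk (intTensorMap R g' f' (intTensorMap R g f s)) = _
    rw [(h _).2 ⟨s, rfl⟩]
    rfl

theorem tensorMap_id_exact {f : M →ₗ[R] M'} {f' : M' →ₗ[R] M''}
    (h : Function.Exact f f') (hf' : Function.Surjective f') :
    Function.Exact (tensorMap R (LinearMap.id : N →ₗ[Rᵐᵒᵖ] N) f)
      (tensorMap R (LinearMap.id : N →ₗ[Rᵐᵒᵖ] N) f') :=
  tensorMap_exact_of_int Function.surjective_id hf'
    (lTensor_exact N (f := f.toAddMonoidHom.toIntLinearMap)
      (g := f'.toAddMonoidHom.toIntLinearMap) h hf')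

theorem tensorMap_exact_id {g : N →ₗ[Rᵐᵒᵖ] N'} {g' : N' →ₗ[Rᵐᵒᵖ] N''}
    (h : Function.Exact g g') (hg' : Function.Surjective g') :
    Function.Exact (tensorMap R g (LinearMap.id : M →ₗ[R] M))
      (tensorMap R g' (LinearMap.id : M →ₗ[R] M)) :=
  tensorMap_exact_of_int hg' Function.surjective_id
    (rTensor_exact M (f := g.toAddMonoidHom.toIntLinearMap)
      (g := g'.toAddMonoidHom.toIntLinearMap) h hg')

instance [Subsingleton M] : Subsingleton (RTensor R N M) := by
  have : Subsingleton (N ⊗[ℤ] M) := inferInstance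
  exact QuotientAddGroup.mk_surjective.subsingleton

end Tensor

/-! ### Flatness of free modules -/

section Free

variable {R : Type u} [Ring R]

/-- The homomorphism `R^(ι) ⊗_R M → M^(ι)` with `p ⊗ y ↦ (p i • y)_i`. -/
noncomputable def freeTensor (ι M : Type u) [AddCommGroup M] [Module R M] :
    RTensor R (ι →₀ Rᵐᵒᵖ) M →+ (ι →₀ M) :=
  tensorLift
    (AddMonoidHom.mk' (fun p => AddMonoidHom.mk'
      (fun y => p.mapRange (fun a => a.unop • y) (by simp))
      (fun y z => by ext; simp)) (fun p q => by ext; simp [add_smul]))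
    (fun p r y => by ext; simp [mul_smul])

@[simp]
theorem freeTensor_tmul_apply {ι M : Type u} [AddCommGroup M] [Module R M] (p : ι →₀ Rᵐᵒᵖ) (y : M)
    (i : ι) : freeTensor ι M (tmul R p y) i = (p i).unop • y := rfl

theorem freeTensor_injective (ι M : Type u) [AddCommGroup M] [Module R M] :
    Function.Injective (freeTensor (R := R) ι M) := by
  let ψ : (ι →₀ M) →+ RTensor R (ι →₀ Rᵐᵒᵖ) M :=
    Finsupp.liftAddHom fun i => AddMonoidHom.mk' (fun y => tmul R (Finsupp.single i 1) y)
      (fun y z => tmul_add R _ y z)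
  have hψ : ψ.comp (freeTensor ι M) = AddMonoidHom.id _ := by
    refine rTensor_hom_ext fun p y => ?_
    induction p using Finsupp.induction_linear with
    | zero =>
      have : tmul R (0 : ι →₀ Rᵐᵒᵖ) y = 0 := by simp [tmul]
      rw [this, map_zero, map_zero]
    | add p q hp hq => rw [add_tmul, map_add, map_add, hp, hq]
    | single i a =>
      have : freeTensor ι M (tmul R (Finsupp.single i a) y) = Finsupp.single i (a.unop • y) := by
        ext j
        by_cases h : i = j <;> simp [h]
      change ψ (freeTensor ι M (tmul R (Finsupp.single i a) y)) = tmul R (Finsupp.single i a) y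
      rw [this]
      change Finsupp.liftAddHom _ _ = _
      rw [Finsupp.liftAddHom_apply_single]
      change tmul R (Finsupp.single i 1) (a.unop • y) = _
      rw [← tmul_op_smul]
      simp
  exact Function.LeftInverse.injective (g := ψ) (DFunLike.congr_fun hψ)

/-- Free right modules are flat. -/
theorem tensorMap_free_injective (ι : Type u) {M M' : Type u} [AddCommGroup M] [Module R M]
    [AddCommGroup M'] [Module R M'] {f : M →ₗ[R] M'} (hf : Function.Injective f) :
    Function.Injective (tensorMap R (LinearMap.id : (ι →₀ Rᵐᵒᵖ) →ₗ[Rᵐᵒᵖ] _) f) := by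
  have hcomm : (freeTensor ι M').comp (tensorMap R LinearMap.id f) =
      (Finsupp.mapRange.addMonoidHom f.toAddMonoidHom).comp (freeTensor ι M) :=
    rTensor_hom_ext fun p y => by ext i; simp
  have hinj : Function.Injective ((freeTensor ι M').comp (tensorMap R LinearMap.id f)) := by
    rw [hcomm]
    exact (Finsupp.mapRange_injective _ (map_zero f) hf).comp (freeTensor_injective ι M)
  exact Function.Injective.of_comp hinj

/-- The homomorphism `N ⊗_R R^(ι) → N^(ι)` with `x ⊗ p ↦ (x (p i))_i`. -/
noncomputable def tensorFree (N ι : Type u) [AddCommGroup N] [Module Rᵐᵒᵖ N] :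
    RTensor R N (ι →₀ R) →+ (ι →₀ N) :=
  tensorLift
    (AddMonoidHom.mk' (fun x => AddMonoidHom.mk'
      (fun p => p.mapRange (fun a => MulOpposite.op a • x) (by simp))
      (fun p q => by ext; simp [add_smul])) (fun x y => by ext; simp))
    (fun x r p => by ext; simp [mul_smul])

@[simp]
theorem tensorFree_tmul_apply {N ι : Type u} [AddCommGroup N] [Module Rᵐᵒᵖ N] (x : N) (p : ι →₀ R)
    (i : ι) : tensorFree N ι (tmul R x p) i = MulOpposite.op (p i) • x := rfl

theorem tensorFree_injective (N ι : Type u) [AddCommGroup N] [Module Rᵐᵒᵖ N] :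
    Function.Injective (tensorFree (R := R) N ι) := by
  let ψ : (ι →₀ N) →+ RTensor R N (ι →₀ R) :=
    Finsupp.liftAddHom fun i => AddMonoidHom.mk' (fun x => tmul R x (Finsupp.single i 1))
      (fun x z => add_tmul R x z _)
  have hψ : ψ.comp (tensorFree N ι) = AddMonoidHom.id _ := by
    refine rTensor_hom_ext fun x p => ?_
    induction p using Finsupp.induction_linear with
    | zero =>
      have : tmul R x (0 : ι →₀ R) = 0 := by simp [tmul]
      rw [this, map_zero, map_zero]
    | add p q hp hq => rw [tmul_add, map_add, map_add, hp, hq]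
    | single i a =>
      have : tensorFree N ι (tmul R x (Finsupp.single i a)) =
          Finsupp.single i (MulOpposite.op a • x) := by
        ext j
        by_cases h : i = j <;> simp [h]
      change ψ (tensorFree N ι (tmul R x (Finsupp.single i a))) = tmul R x (Finsupp.single i a)
      rw [this]
      change Finsupp.liftAddHom _ _ = _
      rw [Finsupp.liftAddHom_apply_single]
      change tmul R (MulOpposite.op a • x) (Finsupp.single i 1) = _
      rw [tmul_op_smul]
      simp
  exact Function.LeftInverse.injective (g := ψ) (DFunLike.congr_fun hψ)

theorem isFlat_finsupp (ι : Type u) : IsFlat R (ι →₀ R) := by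
  intro N N' _ _ _ _ g hg
  have hcomm : (tensorFree N' ι).comp (tensorMap R g LinearMap.id) =
      (Finsupp.mapRange.addMonoidHom g.toAddMonoidHom).comp (tensorFree N ι) :=
    rTensor_hom_ext fun x p => by ext i; simp
  have hinj : Function.Injective ((tensorFree N' ι).comp
      (tensorMap R g (LinearMap.id : (ι →₀ R) →ₗ[R] _))) := by
    rw [hcomm]
    exact (Finsupp.mapRange_injective _ (map_zero g) hg).comp (tensorFree_injective N ι)
  exact Function.Injective.of_comp hinj

theorem IsFlat.of_subsingleton (M : Type u) [AddCommGroup M] [Module R M] [Subsingleton M] :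
    IsFlat R M := fun _ _ _ _ _ _ _ _ => Function.injective_of_subsingleton _

end Free

/-! ### Vanishing of Tor -/

section Syzygy

variable {R : Type u} [Ring R]

/-- The first syzygy of a right module `N` with respect to its canonical free cover
`R^(N) → N`. -/
def Syzygy (R : Type u) [Ring R] (N : Type u) [AddCommGroup N] [Module Rᵐᵒᵖ N] : Type u :=
  LinearMap.ker (Finsupp.linearCombination Rᵐᵒᵖ (id : N → N))

section

variable (R : Type u) [Ring R] (N : Type u) [AddCommGroup N] [Module Rᵐᵒᵖ N]

noncomputable instance : AddCommGroup (Syzygy R N) :=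
  inferInstanceAs (AddCommGroup (LinearMap.ker (Finsupp.linearCombination Rᵐᵒᵖ (id : N → N))))

noncomputable instance : Module Rᵐᵒᵖ (Syzygy R N) :=
  inferInstanceAs (Module Rᵐᵒᵖ (LinearMap.ker (Finsupp.linearCombination Rᵐᵒᵖ (id : N → N))))

/-- The inclusion of the first syzygy of `N` into the canonical free cover of `N`. -/
noncomputable def syzygyInclusion : Syzygy R N →ₗ[Rᵐᵒᵖ] (N →₀ Rᵐᵒᵖ) :=
  (LinearMap.ker (Finsupp.linearCombination Rᵐᵒᵖ (id : N → N))).subtype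

theorem syzygyInclusion_injective : Function.Injective (syzygyInclusion R N) :=
  Subtype.val_injective

theorem syzygyInclusion_exact :
    Function.Exact (syzygyInclusion R N) (Finsupp.linearCombination Rᵐᵒᵖ (id : N → N)) :=
  (Finsupp.linearCombination Rᵐᵒᵖ (id : N → N)).exact_subtype_ker_map

end

/-- The condition `Tor_1(N, M) = 0`, in terms of the canonical free cover of the right
module `N`. -/
def TorVanishes (R : Type u) [Ring R] (N M : Type u) [AddCommGroup N] [Module Rᵐᵒᵖ N]
    [AddCommGroup M] [Module R M] : Prop :=
  Function.Injective (tensorMap R (syzygyInclusion R N) (LinearMap.id : M →ₗ[R] M))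

variable {N P J K F M : Type u} [AddCommGroup N] [Module Rᵐᵒᵖ N] [AddCommGroup P] [Module Rᵐᵒᵖ P]
  [AddCommGroup J] [Module Rᵐᵒᵖ J] [AddCommGroup K] [Module R K] [AddCommGroup F] [Module R F]
  [AddCommGroup M] [Module R M] {i : K →ₗ[R] F} {p : F →ₗ[R] M} {j : J →ₗ[Rᵐᵒᵖ] P}
  {q : P →ₗ[Rᵐᵒᵖ] N}

/-- The group `Tor_1(N, M)` can be computed from either variable: a diagram chase in the square
obtained by tensoring a flat presentation of `N` with one of `M`. -/
theorem tensorMap_injective_balanced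
    (hFj : Function.Injective (tensorMap R j (LinearMap.id : F →ₗ[R] F)))
    (hPi : Function.Injective (tensorMap R (LinearMap.id : P →ₗ[Rᵐᵒᵖ] P) i))
    (hjq : Function.Exact j q) (hq : Function.Surjective q)
    (hip : Function.Exact i p) (hp : Function.Surjective p) :
    Function.Injective (tensorMap R j (LinearMap.id : M →ₗ[R] M)) ↔
      Function.Injective (tensorMap R (LinearMap.id : N →ₗ[Rᵐᵒᵖ] N) i) := by
  have exi {L : Type u} [AddCommGroup L] [Module Rᵐᵒᵖ L] := tensorMap_id_exact (N := L) hip hp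
  have exj {L : Type u} [AddCommGroup L] [Module R L] := tensorMap_exact_id (M := L) hjq hq
  constructor
  · intro h
    refine (injective_iff_map_eq_zero _).2 fun x hx => ?_
    obtain ⟨y, rfl⟩ := tensorMap_surjective hq (f := LinearMap.id) Function.surjective_id x
    rw [tensorMap_comm] at hx
    obtain ⟨w, hw⟩ := (exj _).1 hx
    have h0 : tensorMap R j LinearMap.id (tensorMap R LinearMap.id p w) = 0 := by
      rw [← tensorMap_comm, hw]
      exact (exi _).2 ⟨y, rfl⟩
    obtain ⟨v, rfl⟩ := (exi _).1 ((injective_iff_map_eq_zero _).1 h _ h0)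
    rw [← tensorMap_comm] at hw
    exact (exj _).2 ⟨v, hPi hw⟩
  · intro h
    refine (injective_iff_map_eq_zero _).2 fun x hx => ?_
    obtain ⟨y, rfl⟩ := tensorMap_surjective (g := LinearMap.id) Function.surjective_id hp x
    rw [← tensorMap_comm] at hx
    obtain ⟨w, hw⟩ := (exi _).1 hx
    have h0 : tensorMap R LinearMap.id i (tensorMap R q LinearMap.id w) = 0 := by
      rw [tensorMap_comm, hw]
      exact (exj _).2 ⟨y, rfl⟩
    obtain ⟨v, rfl⟩ := (exj _).1 ((injective_iff_map_eq_zero _).1 h _ h0)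
    rw [tensorMap_comm] at hw
    exact (exi _).2 ⟨v, hFj hw⟩

/-- Both sides are equivalent to the condition that `J ⊗ K → P ⊗ F` is
injective. -/
theorem tensorMap_injective_swap
    (hFj : Function.Injective (tensorMap R j (LinearMap.id : F →ₗ[R] F)))
    (hPi : Function.Injective (tensorMap R (LinearMap.id : P →ₗ[Rᵐᵒᵖ] P) i)) :
    Function.Injective (tensorMap R (LinearMap.id : J →ₗ[Rᵐᵒᵖ] J) i) ↔
      Function.Injective (tensorMap R j (LinearMap.id : K →ₗ[R] K)) := by
  have hcomp : (tensorMap R (LinearMap.id : P →ₗ[Rᵐᵒᵖ] P) i) ∘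
      (tensorMap R j (LinearMap.id : K →ₗ[R] K)) =
      (tensorMap R j (LinearMap.id : F →ₗ[R] F)) ∘
      (tensorMap R (LinearMap.id : J →ₗ[Rᵐᵒᵖ] J) i) := funext fun t => tensorMap_comm _ _ t
  rw [← hFj.of_comp_iff, ← hcomp, hPi.of_comp_iff]

theorem torVanishes_iff (hF : IsFlat R F) (hi : Function.Injective i) (hip : Function.Exact i p)
    (hp : Function.Surjective p) :
    TorVanishes R N M ↔ Function.Injective (tensorMap R (LinearMap.id : N →ₗ[Rᵐᵒᵖ] N) i) :=
  tensorMap_injective_balanced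
    (hF _ _ _ (syzygyInclusion_injective R N))
    (tensorMap_free_injective N hi) (syzygyInclusion_exact R N)
    (Finsupp.linearCombination_id_surjective Rᵐᵒᵖ N) hip hp

/-- Dimension shifting: `Tor_2(N, M) = Tor_1(Ω N, M) = Tor_1(N, K)` for `0 → K → F → M → 0` exact
with `F` flat. -/
theorem torVanishes_syzygy_iff (hF : IsFlat R F) (hi : Function.Injective i)
    (hip : Function.Exact i p) (hp : Function.Surjective p) :
    TorVanishes R (Syzygy R N) M ↔ TorVanishes R N K :=
  (torVanishes_iff hF hi hip hp).trans <|
    tensorMap_injective_swap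
      (hF _ _ _ (syzygyInclusion_injective R N))
      (tensorMap_free_injective N hi)

/-- The right modules `Ω^k I` with `I` injective and `k ≥ 0`. -/
inductive IsInjectiveSyzygy (R : Type u) [Ring R] : ModuleCat.{u} Rᵐᵒᵖ → Prop
  | injective (I : ModuleCat.{u} Rᵐᵒᵖ) : Module.Injective Rᵐᵒᵖ I → IsInjectiveSyzygy R I
  | syzygy (N : ModuleCat.{u} Rᵐᵒᵖ) : IsInjectiveSyzygy R N →
      IsInjectiveSyzygy R (ModuleCat.of Rᵐᵒᵖ (Syzygy R N))

/-- The condition that `Tor_k(I, M) = 0` for all `k ≥ 1` and all injective right modules `I`. -/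
def TorInjVanishes (R : Type u) [Ring R] (M : Type u) [AddCommGroup M] [Module R M] : Prop :=
  ∀ N : ModuleCat.{u} Rᵐᵒᵖ, IsInjectiveSyzygy R N → TorVanishes R N M

theorem TorInjVanishes.tensorMap_injective (hM : TorInjVanishes R M) (hF : IsFlat R F)
    (hi : Function.Injective i) (hip : Function.Exact i p) (hp : Function.Surjective p)
    (hN : Module.Injective Rᵐᵒᵖ N) :
    Function.Injective (tensorMap R (LinearMap.id : N →ₗ[Rᵐᵒᵖ] N) i) :=
  (torVanishes_iff hF hi hip hp).1 (hM (ModuleCat.of _ N) (.injective _ hN))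

theorem TorInjVanishes.of_exact (hM : TorInjVanishes R M) (hF : IsFlat R F)
    (hi : Function.Injective i) (hip : Function.Exact i p) (hp : Function.Surjective p) :
    TorInjVanishes R K := fun N hN =>
  (torVanishes_syzygy_iff hF hi hip hp).1 (hM _ (.syzygy N hN))

end Syzygy

/-! ### Flat resolutions and coresolutions -/

section Resolutions

variable {R : Type u} [Ring R]

/-- Exactness of `X → Y → Z` that is preserved by `I ⊗_R -` for all injective right modules `I`. -/
def InjExact {X Y Z : Type u} [AddCommGroup X] [Module R X] [AddCommGroup Y] [Module R Y]
    [AddCommGroup Z] [Module R Z] (f : X →ₗ[R] Y) (g : Y →ₗ[R] Z) : Prop :=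
  Function.Exact f g ∧ ∀ (I : Type u) [AddCommGroup I] [Module Rᵐᵒᵖ I], Module.Injective Rᵐᵒᵖ I →
    Function.Exact (tensorMap R (LinearMap.id : I →ₗ[Rᵐᵒᵖ] I) f)
      (tensorMap R (LinearMap.id : I →ₗ[Rᵐᵒᵖ] I) g)

/-- Injectivity that is preserved by `I ⊗_R -` for all injective right modules `I`. -/
def InjMono {X Y : Type u} [AddCommGroup X] [Module R X] [AddCommGroup Y] [Module R Y]
    (f : X →ₗ[R] Y) : Prop :=
  Function.Injective f ∧
    ∀ (I : Type u) [AddCommGroup I] [Module Rᵐᵒᵖ I], Module.Injective Rᵐᵒᵖ I →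
      Function.Injective (tensorMap R (LinearMap.id : I →ₗ[Rᵐᵒᵖ] I) f)

/-- `M` has a flat resolution `⋯ → P 1 → P 0 → M → 0` that stays exact under `I ⊗_R -` for all
injective right modules `I`. -/
def HasFlatResolution (R : Type u) [Ring R] (M : Type u) [AddCommGroup M] [Module R M] : Prop :=
  ∃ (P : ℕ → ModuleCat.{u} R) (d : ∀ k, P (k + 1) →ₗ[R] P k) (ε : P 0 →ₗ[R] M),
    (∀ k, IsFlat R (P k)) ∧ (∀ k, InjExact (d (k + 1)) (d k)) ∧ InjExact (d 0) ε ∧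
    Function.Surjective ε

/-- `M` has a flat coresolution `0 → M → E 0 → E 1 → ⋯` that stays exact under `I ⊗_R -` for all
injective right modules `I`. -/
def HasFlatCoresolution (R : Type u) [Ring R] (M : Type u) [AddCommGroup M] [Module R M] : Prop :=
  ∃ (E : ℕ → ModuleCat.{u} R) (d : ∀ k, E k →ₗ[R] E (k + 1)) (η : M →ₗ[R] E 0),
    (∀ k, IsFlat R (E k)) ∧ (∀ k, InjExact (d k) (d (k + 1))) ∧ InjExact η (d 0) ∧ InjMono η

section Maps

variable {W X Y Z : Type u} [AddCommGroup W] [Module R W] [AddCommGroup X] [Module R X]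
  [AddCommGroup Y] [Module R Y] [AddCommGroup Z] [Module R Z]
  {f : X →ₗ[R] Y} {g : Y →ₗ[R] Z}

theorem injExact_of_surjective (h : Function.Exact f g) (hg : Function.Surjective g) :
    InjExact f g := ⟨h, fun _ _ _ _ => tensorMap_id_exact h hg⟩

theorem InjExact.comp_right (h : InjExact f g) {η : Z →ₗ[R] W} (hη : InjMono η) :
    InjExact f (η ∘ₗ g) := by
  refine ⟨h.1.comp_injective η hη.1 (map_zero η), fun I _ _ hI => ?_⟩
  rw [tensorMap_id_comp]
  exact (h.2 I hI).comp_injective _ (hη.2 I hI) (map_zero _)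

theorem InjExact.comp_left (h : InjExact f g) {ε : W →ₗ[R] X} (hε : Function.Surjective ε) :
    InjExact (f ∘ₗ ε) g := by
  refine ⟨fun y => by rw [h.1 y, LinearMap.coe_comp, hε.range_comp], fun I _ _ hI => ?_⟩
  rw [tensorMap_id_comp]
  intro y
  rw [h.2 I hI y, (tensorMap_surjective Function.surjective_id hε).range_comp]

theorem InjExact.of_comp_left {ε : W →ₗ[R] X} (h : InjExact (f ∘ₗ ε) g)
    (hε : Function.Surjective ε) : InjExact f g := by
  refine ⟨fun y => ?_, fun I _ _ hI y => ?_⟩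
  · rw [h.1 y, LinearMap.coe_comp, hε.range_comp]
  · have := h.2 I hI y
    rw [tensorMap_id_comp] at this
    rw [this, (tensorMap_surjective Function.surjective_id hε).range_comp]

/-- If `X → Y → W` is exact and `Y → W` factors through an epimorphism `Y → Z` that vanishes on `X`,
then `Z` is the cokernel of `X → Y`, so that `Z → W` is injective, before and after tensoring. -/
theorem InjExact.injMono_of_comp {η : Z →ₗ[R] W} (h : InjExact f (η ∘ₗ g))
    (hg : Function.Surjective g) (hfg : g ∘ₗ f = 0) : InjMono η := by
  refine ⟨(injective_iff_map_eq_zero _).2 fun x hx => ?_,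
    fun I _ _ hI => (injective_iff_map_eq_zero _).2 fun x hx => ?_⟩
  · obtain ⟨y, rfl⟩ := hg x
    obtain ⟨w, rfl⟩ := (h.1 y).1 hx
    exact LinearMap.congr_fun hfg w
  · obtain ⟨y, rfl⟩ := tensorMap_surjective (g := LinearMap.id) Function.surjective_id hg x
    rw [← Function.comp_apply (f := tensorMap R LinearMap.id η), ← tensorMap_id_comp] at hx
    obtain ⟨w, rfl⟩ := (h.2 I hI y).1 hx
    rw [← Function.comp_apply (f := tensorMap R LinearMap.id g), ← tensorMap_id_comp, hfg]
    have h0 : tensorMap R LinearMap.id (0 : X →ₗ[R] Z) = (0 : RTensor R I X →+ _) :=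
      rTensor_hom_ext fun x y => by
        rw [tensorMap_tmul]
        simp [tmul]
    rw [h0]
    rfl

theorem injExact_of_subsingleton [Subsingleton Y] : InjExact f g := by
  refine ⟨fun y => ?_, fun I _ _ hI y => ?_⟩
  · simpa [Subsingleton.elim y 0] using ⟨0, map_zero _⟩
  · simpa [Subsingleton.elim y 0] using ⟨0, map_zero _⟩

end Maps

section Gorenstein

variable {M : Type u} [AddCommGroup M] [Module R M]

/-- The terms of the two-sided complex with left half `P` and right half `E`: the term
`P 0` has degree `0`, and `E 0` has degree `1`. -/
def spliceObj (P E : ℕ → ModuleCat.{u} R) : ℤ → ModuleCat.{u} R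
  | .ofNat 0 => P 0
  | .ofNat (k + 1) => E k
  | .negSucc k => P (k + 1)

/-- The differentials of the two-sided complex obtained by gluing `P` and `E` along `c`. -/
def spliceMap {P E : ℕ → ModuleCat.{u} R} (d : ∀ k, P (k + 1) →ₗ[R] P k)
    (e : ∀ k, E k →ₗ[R] E (k + 1)) (c : P 0 →ₗ[R] E 0) :
    ∀ n : ℤ, spliceObj P E n →ₗ[R] spliceObj P E (n + 1)
  | .ofNat 0 => c
  | .ofNat (k + 1) => e k
  | .negSucc 0 => d 0
  | .negSucc (k + 1) => d (k + 1)

/-- The differentials of the left half of a two-sided complex, reindexed by the natural numbers. The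
case distinction makes `negSucc k + 1` reduce to `negOfNat k`. -/
def leftMap {F : ℤ → ModuleCat.{u} R} (d : ∀ n : ℤ, F n →ₗ[R] F (n + 1)) :
    ∀ k : ℕ, F (Int.negOfNat (k + 1)) →ₗ[R] F (Int.negOfNat k)
  | 0 => d (.negSucc 0)
  | k + 1 => d (.negSucc (k + 1))

/-- Gorenstein flatness in terms of the two halves of a complete flat resolution. -/
theorem isGorensteinFlat_iff :
    IsGorensteinFlat R M ↔ HasFlatResolution R M ∧ HasFlatCoresolution R M := by
  constructor
  · rintro ⟨F, d, hF, hd, ⟨φ⟩, hdI⟩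
    have hG : ∀ n, InjExact (d n) (d (n + 1)) := fun n => ⟨hd n, fun I _ _ hI => hdI I hI n⟩
    let ε : F 0 →ₗ[R] M := φ.symm.toLinearMap ∘ₗ (d 0).rangeRestrict
    let η : M →ₗ[R] F (0 + 1) := (LinearMap.range (d 0)).subtype ∘ₗ φ.toLinearMap
    have hε : Function.Surjective ε :=
      φ.symm.surjective.comp (LinearMap.surjective_rangeRestrict _)
    have hηε : η ∘ₗ ε = d 0 := by ext x; simp [η, ε]
    have hηi : Function.Injective η := Subtype.val_injective.comp φ.injective
    have h0 : Function.Exact (d (-1)) ε := fun x => by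
      rw [← (hd (-1)) x, ← map_eq_zero_iff η hηi]
      exact Eq.congr_left (LinearMap.congr_fun hηε x)
    have hη : InjMono η := by
      refine InjExact.injMono_of_comp (f := d (-1)) (g := ε) ?_ hε h0.linearMap_comp_eq_zero
      rw [hηε]
      exact hG (-1)
    refine ⟨⟨fun k => F (Int.negOfNat k), leftMap d, ε, fun k => hF _, ?_,
      injExact_of_surjective h0 hε, hε⟩, ⟨fun k => F (.ofNat (k + 1)), fun k => d (.ofNat (k + 1)),
      η, fun k => hF _, fun k => hG (.ofNat (k + 1)), ?_, hη⟩⟩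
    · rintro (_ | k)
      exacts [hG (.negSucc 1), hG (.negSucc (k + 2))]
    · refine InjExact.of_comp_left (ε := ε) ?_ hε
      rw [hηε]
      exact hG 0
  · rintro ⟨⟨P, d, ε, hP, hd, hdε, hε⟩, E, e, η, hE, he, hηe, hη⟩
    have key : ∀ n, InjExact (spliceMap d e (η ∘ₗ ε) n) (spliceMap d e (η ∘ₗ ε) (n + 1)) := by
      rintro ((_ | k) | (_ | _ | k))
      · exact hηe.comp_left hε
      · exact he k
      · exact hdε.comp_right hη
      · exact hd 0
      · exact hd (k + 1)
    refine ⟨spliceObj P E, spliceMap d e (η ∘ₗ ε), ?_, fun n => (key n).1, ⟨?_⟩,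
      fun I _ _ hI n => (key n).2 I hI⟩
    · rintro ((_ | k) | k)
      exacts [hP 0, hE k, hP (k + 1)]
    · refine (LinearEquiv.ofInjective η hη.1).trans (LinearEquiv.ofEq _ _ ?_)
      exact (LinearMap.range_comp_of_range_eq_top η (LinearMap.range_eq_top.2 hε)).symm

end Gorenstein

end Resolutions

/-! ### Short exact sequences -/

section ShortExact

variable {R : Type u} [Ring R] {A B C K G F : Type u}
  [AddCommGroup A] [Module R A] [AddCommGroup B] [Module R B] [AddCommGroup C] [Module R C]
  [AddCommGroup K] [Module R K] [AddCommGroup G] [Module R G] [AddCommGroup F] [Module R F]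

/-- The sequence `0 → A → B → C → 0` is exact. -/
structure IsShortExact (f : A →ₗ[R] B) (g : B →ₗ[R] C) : Prop where
  injective : Function.Injective f
  exact : Function.Exact f g
  surjective : Function.Surjective g

theorem isShortExact_ker {g : B →ₗ[R] C} (hg : Function.Surjective g) :
    IsShortExact (LinearMap.ker g).subtype g :=
  ⟨Subtype.val_injective, g.exact_subtype_ker_map, hg⟩

theorem isShortExact_syzygy (R : Type u) [Ring R] (M : Type u) [AddCommGroup M] [Module R M] :
    IsShortExact (A := LinearMap.ker (Finsupp.linearCombination R (id : M → M)))
      (LinearMap.ker (Finsupp.linearCombination R (id : M → M))).subtype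
      (Finsupp.linearCombination R (id : M → M)) :=
  isShortExact_ker (Finsupp.linearCombination_id_surjective R M)

theorem IsShortExact.exists_pullback {f : A →ₗ[R] B} {g : B →ₗ[R] C} {k : K →ₗ[R] G}
    {h : G →ₗ[R] C} (hfg : IsShortExact f g) (hkh : IsShortExact k h) :
    ∃ (P : ModuleCat.{u} R) (a : A →ₗ[R] P) (b : P →ₗ[R] G) (c : K →ₗ[R] P) (d : P →ₗ[R] B),
      IsShortExact a b ∧ IsShortExact c d := by
  let P := LinearMap.ker (g ∘ₗ LinearMap.fst R B G - h ∘ₗ LinearMap.snd R B G)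
  have hP : ∀ x : P, g x.1.1 = h x.1.2 := fun x => sub_eq_zero.1 x.2
  let mk : ∀ (x : B) (y : G), g x = h y → P := fun x y e => ⟨(x, y), sub_eq_zero.2 e⟩
  refine ⟨ModuleCat.of R P,
    (LinearMap.inl R B G ∘ₗ f).codRestrict P (fun x => by
      simp [P, hfg.exact.apply_apply_eq_zero]), LinearMap.snd R B G ∘ₗ P.subtype,
    (LinearMap.inr R B G ∘ₗ k).codRestrict P (fun x => by
      simp [P, hkh.exact.apply_apply_eq_zero]), LinearMap.fst R B G ∘ₗ P.subtype,
    ⟨fun x y e => ?_, fun x => ⟨fun e => ?_, ?_⟩, fun y => ?_⟩,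
    ⟨fun x y e => ?_, fun x => ⟨fun e => ?_, ?_⟩, fun y => ?_⟩⟩
  · exact hfg.injective (congrArg (fun z : P => z.1.1) e)
  · change x.1.2 = 0 at e
    obtain ⟨a, ha⟩ := (hfg.exact x.1.1).1 (by rw [hP x, e, map_zero])
    exact ⟨a, Subtype.ext (Prod.ext ha e.symm)⟩
  · rintro ⟨a, rfl⟩
    rfl
  · obtain ⟨x, hx⟩ := hfg.surjective (h y)
    exact ⟨mk x y hx, rfl⟩
  · exact hkh.injective (congrArg (fun z : P => z.1.2) e)
  · change x.1.1 = 0 at e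
    obtain ⟨a, ha⟩ := (hkh.exact x.1.2).1 (by rw [← hP x, e, map_zero])
    exact ⟨a, Subtype.ext (Prod.ext e.symm ha)⟩
  · rintro ⟨a, rfl⟩
    rfl
  · obtain ⟨x, hx⟩ := hkh.surjective (g y)
    exact ⟨mk y x hx.symm, rfl⟩

/-- The kernel of a composite of epimorphisms is an extension of their kernels. -/
theorem IsShortExact.exists_ker_comp {k : K →ₗ[R] G} {u : G →ₗ[R] B} {f : A →ₗ[R] B}
    {g : B →ₗ[R] C} (hku : IsShortExact k u) (hfg : IsShortExact f g) :
    ∃ (L : ModuleCat.{u} R) (l : L →ₗ[R] G) (a : K →ₗ[R] L) (b : L →ₗ[R] A),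
      IsShortExact l (g ∘ₗ u) ∧ IsShortExact a b := by
  let L := LinearMap.ker (g ∘ₗ u)
  let e := LinearEquiv.ofInjective f hfg.injective
  have hL : ∀ x : L, (u ∘ₗ L.subtype) x ∈ LinearMap.range f :=
    fun x => (hfg.exact _).1 x.2
  let b : L →ₗ[R] A := e.symm.toLinearMap ∘ₗ (u ∘ₗ L.subtype).codRestrict _ hL
  have hb : ∀ x, f (b x) = u x := fun x =>
    congrArg Subtype.val (e.apply_symm_apply ⟨_, hL x⟩)
  refine ⟨ModuleCat.of R L, L.subtype,
    k.codRestrict L (fun x => by simp [L, hku.exact.apply_apply_eq_zero]), b,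
    isShortExact_ker (hfg.surjective.comp hku.surjective),
    ⟨fun x y h => hku.injective (congrArg Subtype.val h), fun x => ⟨fun h => ?_, ?_⟩,
      fun y => ?_⟩⟩
  · obtain ⟨y, hy⟩ := (hku.exact x.1).1 (by rw [← hb x, h, map_zero])
    exact ⟨y, Subtype.ext hy⟩
  · rintro ⟨y, rfl⟩
    refine hfg.injective ?_
    exact (hb _).trans ((hku.exact.apply_apply_eq_zero y).trans (map_zero f).symm)
  · obtain ⟨x, hx⟩ := hku.surjective (f y)
    have hxL : x ∈ L := by
      change g (u x) = 0
      rw [hx, hfg.exact.apply_apply_eq_zero]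
    exact ⟨⟨x, hxL⟩, hfg.injective ((hb _).trans hx)⟩

/-- The cokernel of a composite of monomorphisms is an extension of their cokernels. -/
theorem IsShortExact.exists_coker_comp {f : A →ₗ[R] B} {g : B →ₗ[R] C} {i : B →ₗ[R] F}
    {p : F →ₗ[R] G} (hfg : IsShortExact f g) (hip : IsShortExact i p) :
    ∃ (E : ModuleCat.{u} R) (q : F →ₗ[R] E) (a : C →ₗ[R] E) (b : E →ₗ[R] G),
      IsShortExact (i ∘ₗ f) q ∧ IsShortExact a b := by
  let S := LinearMap.range (i ∘ₗ f)
  have hker : LinearMap.ker g ≤ LinearMap.ker (S.mkQ ∘ₗ i) := by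
    intro x hx
    obtain ⟨y, rfl⟩ := (hfg.exact x).1 hx
    exact (Submodule.Quotient.mk_eq_zero S).2 ⟨y, rfl⟩
  let a : C →ₗ[R] F ⧸ S := (LinearMap.ker g).liftQ (S.mkQ ∘ₗ i) hker ∘ₗ
    (g.quotKerEquivOfSurjective hfg.surjective).symm.toLinearMap
  have ha : ∀ x, a (g x) = S.mkQ (i x) := by
    intro x
    have : (g.quotKerEquivOfSurjective hfg.surjective).symm (g x) =
        (LinearMap.ker g).mkQ x := by
      rw [LinearEquiv.symm_apply_eq]
      rfl
    simp only [a, LinearMap.comp_apply, LinearEquiv.coe_coe, this]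
    rfl
  let b : F ⧸ S →ₗ[R] G := S.liftQ p (by
    rintro _ ⟨x, rfl⟩
    exact hip.exact.apply_apply_eq_zero (f x))
  refine ⟨ModuleCat.of R (F ⧸ S), S.mkQ, a, b,
    ⟨hip.injective.comp hfg.injective, ?_, S.mkQ_surjective⟩,
    ⟨(injective_iff_map_eq_zero a).2 fun y hy => ?_, fun x => ⟨fun h => ?_, ?_⟩, fun y => ?_⟩⟩
  · exact (i ∘ₗ f).exact_map_mkQ_range
  · obtain ⟨x, rfl⟩ := hfg.surjective y
    rw [ha] at hy
    obtain ⟨z, hz⟩ := (Submodule.Quotient.mk_eq_zero S).1 hy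
    rw [← hip.injective hz]
    exact hfg.exact.apply_apply_eq_zero z
  · obtain ⟨x, rfl⟩ := S.mkQ_surjective x
    obtain ⟨y, rfl⟩ := (hip.exact x).1 h
    exact ⟨g y, ha y⟩
  · rintro ⟨y, rfl⟩
    obtain ⟨x, rfl⟩ := hfg.surjective y
    rw [ha]
    exact hip.exact.apply_apply_eq_zero x
  · obtain ⟨x, rfl⟩ := hip.surjective y
    exact ⟨S.mkQ x, rfl⟩

end ShortExact

/-! ### Gorenstein flat modules -/

section Tor

variable {R : Type u} [Ring R] {M A E F : Type u} [AddCommGroup M] [Module R M]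
  [AddCommGroup A] [Module R A] [AddCommGroup E] [Module R E] [AddCommGroup F] [Module R F]

/-- The first step of a flat resolution; the syzygy inherits the rest of the resolution. -/
theorem HasFlatResolution.exists_syzygy (h : HasFlatResolution R M) :
    ∃ (K F : ModuleCat.{u} R) (i : K →ₗ[R] F) (p : F →ₗ[R] M), IsShortExact i p ∧ IsFlat R F ∧
      InjMono i ∧ HasFlatResolution R K := by
  obtain ⟨P, d, ε, hP, hd, hdε, hε⟩ := h
  let K := LinearMap.ker ε
  let ε' : P 1 →ₗ[R] K := (d 0).codRestrict K (fun x => hdε.1.apply_apply_eq_zero x)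
  have hε' : Function.Surjective ε' := fun y =>
    let ⟨x, hx⟩ := (hdε.1 y.1).1 y.2
    ⟨x, Subtype.ext hx⟩
  have hcomp : K.subtype ∘ₗ ε' = d 0 := rfl
  have hdε' : Function.Exact (d 1) ε' := fun x => by
    rw [← hd 0 |>.1 x, ← hcomp]
    exact (map_eq_zero_iff K.subtype Subtype.val_injective).symm
  exact ⟨ModuleCat.of R K, P 0, K.subtype, ε, isShortExact_ker hε, hP 0,
    (hd 0).injMono_of_comp (g := ε') hε' hdε'.linearMap_comp_eq_zero,
    fun k => P (k + 1), fun k => d (k + 1), ε', fun k => hP _, fun k => hd _,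
    injExact_of_surjective hdε' hε', hε'⟩

theorem HasFlatResolution.torInjVanishes (h : HasFlatResolution R M) : TorInjVanishes R M := by
  intro N hN
  induction hN generalizing M with
  | injective I hI =>
    obtain ⟨K, F, i, p, hip, hF, hi, -⟩ := h.exists_syzygy
    exact (torVanishes_iff hF hip.injective hip.exact hip.surjective).2 (hi.2 I hI)
  | syzygy N hN ih =>
    obtain ⟨K, F, i, p, hip, hF, -, hK⟩ := h.exists_syzygy
    exact (torVanishes_syzygy_iff hF hip.injective hip.exact hip.surjective).2 (ih hK)

/-- The iterated syzygies of the canonical free resolution of a left module. -/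
noncomputable def iterSyzygy (M : ModuleCat.{u} R) : ℕ → ModuleCat.{u} R
  | 0 => M
  | k + 1 => ModuleCat.of R
      (LinearMap.ker (Finsupp.linearCombination R (id : iterSyzygy M k → iterSyzygy M k)))

theorem TorInjVanishes.iterSyzygy (h : TorInjVanishes R M) (k : ℕ) :
    TorInjVanishes R (iterSyzygy (ModuleCat.of R M) k) := by
  induction k with
  | zero => exact h
  | succ k ih =>
    have hs := isShortExact_syzygy R (GorensteinFlat.iterSyzygy (ModuleCat.of R M) k)
    exact ih.of_exact (isFlat_finsupp _) hs.injective hs.exact hs.surjective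

/-- Under the vanishing condition, the canonical free resolution stays exact after tensoring. -/
theorem TorInjVanishes.hasFlatResolution (h : TorInjVanishes R M) : HasFlatResolution R M := by
  let Z := GorensteinFlat.iterSyzygy (ModuleCat.of R M)
  let ε : ∀ k, (Z k →₀ R) →ₗ[R] Z k := fun k => Finsupp.linearCombination R id
  let i : ∀ k, Z (k + 1) →ₗ[R] (Z k →₀ R) := fun k => (LinearMap.ker (ε k)).subtype
  have hs : ∀ k, IsShortExact (i k) (ε k) := fun k => isShortExact_syzygy R (Z k)
  have hi : ∀ k, InjMono (i k) := fun k => ⟨(hs k).injective, fun I _ _ hI =>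
    (h.iterSyzygy k).tensorMap_injective (isFlat_finsupp _) (hs k).injective (hs k).exact
      (hs k).surjective hI⟩
  have hε : ∀ k, InjExact (i k ∘ₗ ε (k + 1)) (ε k) := fun k =>
    (injExact_of_surjective (hs k).exact (hs k).surjective).comp_left (hs (k + 1)).surjective
  exact ⟨fun k => ModuleCat.of R (Z k →₀ R), fun k => i k ∘ₗ ε (k + 1), ε 0,
    fun k => isFlat_finsupp _, fun k => (hε (k + 1)).comp_right (hi k), hε 0, (hs 0).surjective⟩

theorem isGorensteinFlat_iff_tor :
    IsGorensteinFlat R M ↔ TorInjVanishes R M ∧ HasFlatCoresolution R M := by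
  rw [isGorensteinFlat_iff]
  exact and_congr_left fun _ =>
    ⟨HasFlatResolution.torInjVanishes, TorInjVanishes.hasFlatResolution⟩

/-- The kernel of an epimorphism from a flat module onto a Gorenstein flat module is Gorenstein
flat. -/
theorem IsGorensteinFlat.of_flat_epi {i : A →ₗ[R] F} {p : F →ₗ[R] E} (hip : IsShortExact i p)
    (hF : IsFlat R F) (hE : IsGorensteinFlat R E) : IsGorensteinFlat R A := by
  obtain ⟨hT, Q, e, η, hQ, he, hηe, hη⟩ := isGorensteinFlat_iff_tor.1 hE
  refine isGorensteinFlat_iff_tor.2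
    ⟨hT.of_exact hF hip.injective hip.exact hip.surjective, ?_⟩
  let Q' : ℕ → ModuleCat.{u} R := fun
    | 0 => ModuleCat.of R F
    | k + 1 => Q k
  let e' : ∀ k, Q' k →ₗ[R] Q' (k + 1) := fun
    | 0 => η ∘ₗ p
    | k + 1 => e k
  refine ⟨Q', e', i, ?_, ?_,
    (injExact_of_surjective hip.exact hip.surjective).comp_right hη, hip.injective,
    fun I _ _ hI => hT.tensorMap_injective hF hip.injective hip.exact hip.surjective hI⟩
  · rintro (_ | k)
    exacts [hF, hQ k]
  · rintro (_ | k)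
    exacts [hηe.comp_left hip.surjective, he k]

theorem IsGorensteinFlat.of_subsingleton (M : Type u) [AddCommGroup M] [Module R M]
    [Subsingleton M] : IsGorensteinFlat R M := by
  refine ⟨fun _ => ModuleCat.of R PUnit, fun _ => 0, fun _ => .of_subsingleton _,
    fun _ => injExact_of_subsingleton.1, ⟨?_⟩, fun I _ _ hI _ => injExact_of_subsingleton.2 I hI⟩
  have : Subsingleton (LinearMap.range
      (0 : ModuleCat.of R PUnit.{u + 1} →ₗ[R] ModuleCat.of R PUnit.{u + 1})) := inferInstance
  exact 0

/-- A flat module `F` is the kernel of `F → 0`. -/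
theorem IsFlat.isGorensteinFlat (hF : IsFlat R F) : IsGorensteinFlat R F :=
  IsGorensteinFlat.of_flat_epi (i := LinearMap.id) (p := (0 : F →ₗ[R] PUnit.{u + 1}))
    ⟨Function.injective_id, fun x => by simp, fun _ => ⟨0, rfl⟩⟩ hF (.of_subsingleton _)

theorem IsGorensteinFlat.of_equiv (h : IsGorensteinFlat R A) (φ : M ≃ₗ[R] A) :
    IsGorensteinFlat R M := by
  obtain ⟨F, d, hF, hd, ⟨ψ⟩, hI⟩ := h
  exact ⟨F, d, hF, hd, ⟨φ.trans ψ⟩, hI⟩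

/-- The cokernel is an image in the same complete flat resolution, shifted by one degree. -/
theorem IsGorensteinFlat.exists_embedding (h : IsGorensteinFlat R M) :
    ∃ (F G : ModuleCat.{u} R) (i : M →ₗ[R] F) (p : F →ₗ[R] G),
      IsShortExact i p ∧ IsFlat R F ∧ IsGorensteinFlat R G := by
  obtain ⟨F, d, hF, hd, ⟨φ⟩, hI⟩ := h
  refine ⟨F 1, ModuleCat.of R (LinearMap.range (d 1)),
    (LinearMap.range (d 0)).subtype ∘ₗ φ.toLinearMap, (d 1).rangeRestrict,
    ⟨Subtype.val_injective.comp φ.injective, fun x => ?_, LinearMap.surjective_rangeRestrict _⟩,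
    hF 1, fun n => F (n + 1), fun n => d (n + 1), fun n => hF _, fun n => hd _,
    ⟨LinearEquiv.refl R _⟩, fun I _ _ h n => hI I h _⟩
  have h1 : (d 1).rangeRestrict x = 0 ↔ d 1 x = 0 := Subtype.ext_iff
  rw [h1, LinearMap.coe_comp, LinearEquiv.coe_coe, φ.surjective.range_comp]
  refine (hd 0 x).trans ?_
  simp

/-- Over a left GF-closed ring the Gorenstein flat modules are closed under kernels of
epimorphisms. With `B` embedded in a flat module `F`, the module `F / A` is an extension of
Gorenstein flat modules. -/
theorem IsLeftGFClosed.of_epi (hR : IsLeftGFClosed R) {A B C : Type u} [AddCommGroup A]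
    [Module R A] [AddCommGroup B] [Module R B] [AddCommGroup C] [Module R C] {f : A →ₗ[R] B}
    {g : B →ₗ[R] C} (hfg : IsShortExact f g) (hB : IsGorensteinFlat R B)
    (hC : IsGorensteinFlat R C) : IsGorensteinFlat R A := by
  obtain ⟨F, G, i, p, hip, hF, hG⟩ := hB.exists_embedding
  obtain ⟨E, q, a, b, hq, hab⟩ := hfg.exists_coker_comp hip
  exact .of_flat_epi hq hF (hR _ _ _ a b hab.injective hab.exact hab.surjective hC hG)

end Tor

/-! ### Gorenstein flat dimension -/

section Dimension

variable {R : Type u} [Ring R] {A B C K G M : Type u}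
  [AddCommGroup A] [Module R A] [AddCommGroup B] [Module R B] [AddCommGroup C] [Module R C]
  [AddCommGroup K] [Module R K] [AddCommGroup G] [Module R G] [AddCommGroup M] [Module R M]

theorem hasGFResolution_zero_iff : HasGFResolution R M 0 ↔ IsGorensteinFlat R M := by
  constructor
  · rintro ⟨G, d, ε, hG, hs, -, hdε, hε⟩
    have := hs 1 one_pos
    have hi : Function.Injective ε := (injective_iff_map_eq_zero ε).2 fun x hx => by
      obtain ⟨y, rfl⟩ := (hdε x).1 hx
      rw [Subsingleton.elim y 0, map_zero]
    exact (hG 0 le_rfl).of_equiv (LinearEquiv.ofBijective ε ⟨hi, hε⟩).symm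
  · intro h
    let G : ℕ → ModuleCat.{u} R := fun
      | 0 => ModuleCat.of R M
      | _ + 1 => ModuleCat.of R PUnit
    refine ⟨G, fun _ => 0, LinearMap.id, ?_, ?_, ?_, fun x => ?_, Function.surjective_id⟩
    · rintro i hi
      obtain rfl := Nat.le_zero.1 hi
      exact h
    · rintro (_ | i) hi
      · exact absurd hi (lt_irrefl 0)
      · exact inferInstanceAs (Subsingleton PUnit)
    · intro i x
      have : x = 0 := Subsingleton.elim (α := PUnit) _ _
      simpa using this.symm
    · simp [eq_comm]

theorem HasGFResolution.exists_cover {n : ℕ} (h : HasGFResolution R M (n + 1)) :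
    ∃ (K G : ModuleCat.{u} R) (i : K →ₗ[R] G) (p : G →ₗ[R] M),
      IsShortExact i p ∧ IsGorensteinFlat R G ∧ HasGFResolution R K n := by
  obtain ⟨G, d, ε, hG, hs, hd, hdε, hε⟩ := h
  let K := LinearMap.ker ε
  let ε' : G 1 →ₗ[R] K := (d 0).codRestrict K (fun x => hdε.apply_apply_eq_zero x)
  have hε' : Function.Surjective ε' := fun y =>
    let ⟨x, hx⟩ := (hdε y.1).1 y.2
    ⟨x, Subtype.ext hx⟩
  have hdε' : Function.Exact (d 1) ε' := fun x => by
    rw [← hd 0 x]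
    exact (map_eq_zero_iff K.subtype Subtype.val_injective).symm
  exact ⟨ModuleCat.of R K, G 0, K.subtype, ε, isShortExact_ker hε, hG 0 (Nat.zero_le _),
    fun k => G (k + 1), fun k => d (k + 1), ε', fun k hk => hG _ (Nat.succ_le_succ hk),
    fun k hk => hs _ (Nat.succ_lt_succ hk), fun k => hd _, hdε', hε'⟩

theorem HasGFResolution.of_cover {n : ℕ} {i : K →ₗ[R] G} {p : G →ₗ[R] M}
    (hip : IsShortExact i p) (hG : IsGorensteinFlat R G) (hK : HasGFResolution R K n) :
    HasGFResolution R M (n + 1) := by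
  obtain ⟨Q, d, ε, hQ, hs, hd, hdε, hε⟩ := hK
  let Q' : ℕ → ModuleCat.{u} R := fun
    | 0 => ModuleCat.of R G
    | k + 1 => Q k
  let d' : ∀ k, Q' (k + 1) →ₗ[R] Q' k := fun
    | 0 => i ∘ₗ ε
    | k + 1 => d k
  refine ⟨Q', d', p, ?_, ?_, ?_, ?_, hip.surjective⟩
  · rintro (_ | k) hk
    exacts [hG, hQ k (Nat.le_of_succ_le_succ hk)]
  · rintro (_ | k) hk
    exacts [absurd hk (Nat.not_lt_zero _), hs k (Nat.lt_of_succ_lt_succ hk)]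
  · rintro (_ | k)
    exacts [hdε.comp_injective i hip.injective (map_zero i), hd k]
  · intro x
    change _ ↔ x ∈ Set.range (i ∘ ε)
    rw [hε.range_comp]
    exact hip.exact x

theorem HasGFResolution.mono {m n : ℕ} (h : HasGFResolution R M m) (hmn : m ≤ n) :
    HasGFResolution R M n := by
  obtain ⟨G, d, ε, hG, hs, hd⟩ := h
  refine ⟨G, d, ε, fun i _ => ?_, fun i hi => hs i (hmn.trans_lt hi), hd⟩
  rcases le_or_gt i m with hi | hi
  · exact hG i hi
  · have := hs i hi
    exact .of_subsingleton _

theorem gfd_le_iff {n : ℕ} : Gfd R M ≤ n ↔ HasGFResolution R M n := by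
  refine ⟨fun h => ?_, fun h => iInf₂_le n h⟩
  by_contra hn
  have h1 : ((n + 1 : ℕ) : ℕ∞) ≤ Gfd R M := le_iInf₂ fun m hm => by
    refine Nat.cast_le.2 (Nat.succ_le_of_lt (lt_of_not_ge fun hmn => hn (hm.mono hmn)))
  exact absurd (Nat.cast_le.1 (h1.trans h)) (by simp)

theorem IsGorensteinFlat.prod (hR : IsLeftGFClosed R) (hA : IsGorensteinFlat R A)
    (hB : IsGorensteinFlat R B) : IsGorensteinFlat R (A × B) :=
  hR _ _ _ (LinearMap.inl R A B) (LinearMap.snd R A B) LinearMap.inl_injective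
    Function.Exact.inl_snd LinearMap.snd_surjective hA hB

theorem HasGFResolution.prod_gf (hR : IsLeftGFClosed R) {n : ℕ} (hA : HasGFResolution R A n)
    (hB : IsGorensteinFlat R B) : HasGFResolution R (A × B) n := by
  cases n with
  | zero =>
    exact hasGFResolution_zero_iff.2 (.prod hR (hasGFResolution_zero_iff.1 hA) hB)
  | succ n =>
    obtain ⟨K, G, i, p, hip, hG, hK⟩ := hA.exists_cover
    refine .of_cover (i := LinearMap.inl R G B ∘ₗ i) (p := p.prodMap LinearMap.id)
      ⟨LinearMap.inl_injective.comp hip.injective, ?_, ?_⟩ (.prod hR hG hB) hK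
    · rintro ⟨x, y⟩
      simp [Prod.ext_iff, hip.exact x, eq_comm (a := y)]
    · exact hip.surjective.prodMap Function.surjective_id

/-- With `G → B` the start of a resolution of `B`, the kernel of `G → B → C` is Gorenstein flat and
starts a resolution of `A` with the same first syzygy. -/
theorem HasGFResolution.of_gf_epi (hR : IsLeftGFClosed R) {n : ℕ} {f : A →ₗ[R] B}
    {g : B →ₗ[R] C} (hfg : IsShortExact f g) (hB : HasGFResolution R B n)
    (hC : IsGorensteinFlat R C) : HasGFResolution R A n := by
  cases n with
  | zero =>
    exact hasGFResolution_zero_iff.2 (hR.of_epi hfg (hasGFResolution_zero_iff.1 hB) hC)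
  | succ n =>
    obtain ⟨K, G, i, p, hip, hG, hK⟩ := hB.exists_cover
    obtain ⟨L, l, a, b, hl, hab⟩ := hip.exists_ker_comp hfg
    exact .of_cover hab (hR.of_epi hl hG hC) hK

/-- The modules with a Gorenstein flat resolution of length `n` are closed under extensions. -/
def ResolutionsExtend (R : Type u) [Ring R] (n : ℕ) : Prop :=
  ∀ ⦃A B C : Type u⦄ [AddCommGroup A] [Module R A] [AddCommGroup B] [Module R B]
    [AddCommGroup C] [Module R C] ⦃f : A →ₗ[R] B⦄ ⦃g : B →ₗ[R] C⦄, IsShortExact f g →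
    HasGFResolution R A n → HasGFResolution R C n → HasGFResolution R B n

/-- With `G → B` the start of a resolution of `B`, the kernel of `G → B → C` is an extension of `A`
by the kernel of `G → B`. -/
theorem ResolutionsExtend.coker {n : ℕ} (hE : ResolutionsExtend R n) {f : A →ₗ[R] B}
    {g : B →ₗ[R] C} (hfg : IsShortExact f g) (hA : HasGFResolution R A n)
    (hB : HasGFResolution R B (n + 1)) : HasGFResolution R C (n + 1) := by
  obtain ⟨K, G, i, p, hip, hG, hK⟩ := hB.exists_cover
  obtain ⟨L, l, a, b, hl, hab⟩ := hip.exists_ker_comp hfg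
  exact .of_cover hl hG (hE hab hK hA)

/-- With `0 → K → G → C → 0` the start of a resolution of `C`, the pullback of `B` and `G` over
`C` is an extension of `B` by `K`, and maps onto `G` with kernel `A`. -/
theorem ResolutionsExtend.ker (hR : IsLeftGFClosed R) {n : ℕ} (hE : ResolutionsExtend R n)
    {f : A →ₗ[R] B} {g : B →ₗ[R] C} (hfg : IsShortExact f g) (hB : HasGFResolution R B n)
    (hC : HasGFResolution R C (n + 1)) : HasGFResolution R A n := by
  obtain ⟨K, G, i, p, hip, hG, hK⟩ := hC.exists_cover
  obtain ⟨P, a, b, c, d, hab, hcd⟩ := hfg.exists_pullback hip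
  exact .of_gf_epi hR hab (hE hcd hK hB) hG

/-- For a free cover `Q → C`, lifted to `Q → B`, the map `A × Q → B` is surjective, and its kernel
is isomorphic to that of `Q → C`. -/
theorem IsShortExact.exists_free_cover {f : A →ₗ[R] B} {g : B →ₗ[R] C} (hfg : IsShortExact f g) :
    ∃ (X : ModuleCat.{u} R) (i : X →ₗ[R] A × (C →₀ R)) (p : A × (C →₀ R) →ₗ[R] B)
      (j : X →ₗ[R] (C →₀ R)) (q : (C →₀ R) →ₗ[R] C), IsShortExact i p ∧ IsShortExact j q := by
  let q := Finsupp.linearCombination R (id : C → C)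
  let s : (C →₀ R) →ₗ[R] B := Finsupp.linearCombination R (Function.surjInv hfg.surjective)
  have hs : g ∘ₗ s = q := by
    ext c
    simp [s, q, Function.surjInv_eq]
  have hs' : ∀ y, g (s y) = q y := LinearMap.congr_fun hs
  let p := f.coprod s
  have hp : Function.Surjective p := by
    intro x
    obtain ⟨y, hy⟩ := Finsupp.linearCombination_id_surjective R C (g x)
    obtain ⟨a, ha⟩ := (hfg.exact (x - s y)).1 (by rw [map_sub, hs', sub_eq_zero]; exact hy.symm)
    exact ⟨(a, y), by simp [p, ha]⟩
  have hpx : ∀ x : LinearMap.ker p, f x.1.1 + s x.1.2 = 0 := fun x => LinearMap.mem_ker.1 x.2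
  refine ⟨ModuleCat.of R (LinearMap.ker p), (LinearMap.ker p).subtype, p,
    LinearMap.snd R A _ ∘ₗ (LinearMap.ker p).subtype, q, isShortExact_ker hp,
    (injective_iff_map_eq_zero _).2 fun x hx => ?_, fun y => ⟨fun hy => ?_, ?_⟩,
    Finsupp.linearCombination_id_surjective R C⟩
  · change x.1.2 = 0 at hx
    have h := hpx x
    rw [hx, map_zero, add_zero] at h
    exact Subtype.ext (Prod.ext ((map_eq_zero_iff f hfg.injective).1 h) hx)
  · obtain ⟨a, ha⟩ := (hfg.exact (s y)).1 (by rw [hs', hy])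
    exact ⟨⟨(-a, y), by simp [p, ha]⟩, rfl⟩
  · rintro ⟨x, rfl⟩
    have h := congrArg g (hpx x)
    rw [map_add, hfg.exact.apply_apply_eq_zero, zero_add, hs', map_zero] at h
    exact h

/-- In the inductive step `B` is the cokernel of a map `X → A × Q`, where `Q` is free and `X` is the
kernel of `Q → C`. -/
theorem resolutionsExtend (hR : IsLeftGFClosed R) (n : ℕ) : ResolutionsExtend R n := by
  induction n with
  | zero =>
    intro A B C _ _ _ _ _ _ f g hfg hA hC
    rw [hasGFResolution_zero_iff] at *
    exact hR A B C f g hfg.injective hfg.exact hfg.surjective hA hC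
  | succ n hE =>
    intro A B C _ _ _ _ _ _ f g hfg hA hC
    obtain ⟨X, i, p, j, q, hip, hjq⟩ := hfg.exists_free_cover
    have hQ : IsGorensteinFlat R (C →₀ R) := (isFlat_finsupp C).isGorensteinFlat
    have hX : HasGFResolution R X n :=
      hE.ker hR hjq ((hasGFResolution_zero_iff.2 hQ).mono n.zero_le) hC
    exact hE.coker hip hX (hA.prod_gf hR hQ)

theorem IsShortExact.gfd_middle_le (hR : IsLeftGFClosed R) {f : A →ₗ[R] B} {g : B →ₗ[R] C}
    (hfg : IsShortExact f g) : Gfd R B ≤ max (Gfd R A) (Gfd R C) := by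
  generalize hm : max (Gfd R A) (Gfd R C) = m
  cases m with
  | top => exact le_top
  | coe m =>
    have hA := (le_max_left _ _).trans_eq hm
    have hC := (le_max_right _ _).trans_eq hm
    rw [gfd_le_iff] at hA hC ⊢
    exact resolutionsExtend hR m hfg hA hC

theorem IsShortExact.gfd_right_le (hR : IsLeftGFClosed R) {f : A →ₗ[R] B} {g : B →ₗ[R] C}
    (hfg : IsShortExact f g) : Gfd R C ≤ max (Gfd R B) (Gfd R A + 1) := by
  generalize hm : max (Gfd R B) (Gfd R A + 1) = m
  cases m with
  | top => exact le_top
  | coe m =>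
    have hB := (le_max_left _ _).trans_eq hm
    have hA := (le_max_right _ _).trans_eq hm
    cases m with
    | zero => simp at hA
    | succ m =>
      rw [gfd_le_iff] at hB ⊢
      rw [Nat.cast_succ, ENat.add_le_add_iff_right ENat.one_ne_top, gfd_le_iff] at hA
      exact (resolutionsExtend hR m).coker hfg hA hB

theorem IsShortExact.gfd_left_le (hR : IsLeftGFClosed R) {f : A →ₗ[R] B} {g : B →ₗ[R] C}
    (hfg : IsShortExact f g) : Gfd R A ≤ max (Gfd R B) (Gfd R C - 1) := by
  generalize hm : max (Gfd R B) (Gfd R C - 1) = m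
  cases m with
  | top => exact le_top
  | coe m =>
    have hB := (le_max_left _ _).trans_eq hm
    have hC := (le_max_right _ _).trans_eq hm
    rw [gfd_le_iff] at hB ⊢
    rw [tsub_le_iff_right, ← Nat.cast_one, ← Nat.cast_add, gfd_le_iff] at hC
    exact (resolutionsExtend hR m).ker hR hfg hB hC

end Dimension

/-- The equalities are formal consequences of the three inequalities. -/
theorem max_equalities_of_le {a b c : ℕ∞} (ha : a ≤ max b (c - 1)) (hb : b ≤ max a c)
    (hc : c ≤ max b (a + 1)) :
    (b ≠ c → a = max b (c - 1)) ∧ (c ≠ a + 1 → b = max a c) ∧ (b ≠ a → c = max b (a + 1)) := by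
  by_cases h : a = ⊤ ∨ b = ⊤ ∨ c = ⊤
  · cases a <;> cases b <;> cases c <;> simp_all
  · push Not at h
    lift a to ℕ using h.1
    lift b to ℕ using h.2.1
    lift c to ℕ using h.2.2
    have hmax : ∀ m n : ℕ, max (m : ℕ∞) n = (max m n : ℕ) := fun m n =>
      ((Nat.mono_cast (α := ℕ∞)).map_max).symm
    have hsub : (c : ℕ∞) - 1 = (c - 1 : ℕ) := by simp
    have hadd : (a : ℕ∞) + 1 = (a + 1 : ℕ) := by simp
    simp only [hsub, hadd, hmax, Nat.cast_le, Nat.cast_inj, ne_eq] at ha hb hc ⊢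
    omega

end GorensteinFlat

theorem theorem2p11 {R : Type u} [Ring R] (hR : GorensteinFlat.IsLeftGFClosed R)
    {A B C : Type u} [AddCommGroup A] [Module R A] [AddCommGroup B] [Module R B]
    [AddCommGroup C] [Module R C] (f : A →ₗ[R] B) (g : B →ₗ[R] C)
    (hf : Function.Injective f) (hfg : Function.Exact f g) (hg : Function.Surjective g) :
    -- finiteness of two of the three dimensions implies finiteness of the third
    ((GorensteinFlat.Gfd R A < ⊤ → GorensteinFlat.Gfd R B < ⊤ → GorensteinFlat.Gfd R C < ⊤) ∧
      (GorensteinFlat.Gfd R A < ⊤ → GorensteinFlat.Gfd R C < ⊤ → GorensteinFlat.Gfd R B < ⊤) ∧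
      (GorensteinFlat.Gfd R B < ⊤ → GorensteinFlat.Gfd R C < ⊤ → GorensteinFlat.Gfd R A < ⊤)) ∧
    -- `x - 1` truncates in `ℕ∞` only at `x = 0`, where the maximum with `Gfd R B ≥ 0` is the same
    (GorensteinFlat.Gfd R A ≤ max (GorensteinFlat.Gfd R B) (GorensteinFlat.Gfd R C - 1) ∧
      (GorensteinFlat.Gfd R B ≠ GorensteinFlat.Gfd R C →
        GorensteinFlat.Gfd R A = max (GorensteinFlat.Gfd R B) (GorensteinFlat.Gfd R C - 1))) ∧
    (GorensteinFlat.Gfd R B ≤ max (GorensteinFlat.Gfd R A) (GorensteinFlat.Gfd R C) ∧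
      (GorensteinFlat.Gfd R C ≠ GorensteinFlat.Gfd R A + 1 →
        GorensteinFlat.Gfd R B = max (GorensteinFlat.Gfd R A) (GorensteinFlat.Gfd R C))) ∧
    (GorensteinFlat.Gfd R C ≤ max (GorensteinFlat.Gfd R B) (GorensteinFlat.Gfd R A + 1) ∧
      (GorensteinFlat.Gfd R B ≠ GorensteinFlat.Gfd R A →
        GorensteinFlat.Gfd R C = max (GorensteinFlat.Gfd R B) (GorensteinFlat.Gfd R A + 1))) := by
  have h : GorensteinFlat.IsShortExact f g := ⟨hf, hfg, hg⟩
  have ha := h.gfd_left_le hR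
  have hb := h.gfd_middle_le hR
  have hc := h.gfd_right_le hR
  obtain ⟨ha', hb', hc'⟩ := GorensteinFlat.max_equalities_of_le ha hb hc
  refine ⟨⟨fun hA hB => ?_, fun hA hC => ?_, fun hB hC => ?_⟩, ⟨ha, ha'⟩, ⟨hb, hb'⟩, ⟨hc, hc'⟩⟩
  · exact hc.trans_lt (max_lt hB (WithTop.add_lt_top.2 ⟨hA, ENat.one_lt_top⟩))
  · exact hb.trans_lt (max_lt hA hC)
  · exact ha.trans_lt (max_lt hB (tsub_le_self.trans_lt hC))
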